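/- All abelian varieties are complex: an abelian variety is a complex torus $V/\Lambda$ that admits a polarisation, i.e. a positive definite Hermitian form $H$ on $V$ (the first Chern class of an ample line bundle $\mathcal L$) with $\operatorname{Im}H(\Lambda,\Lambda)\subset\mathbb Z$; $\varphi_{\mathcal L}:V/\Lambda\to\widehat{V/\Lambda}$, $x\mapsto t_x^*\mathcal L\otimes\mathcal L^{-1}$, i.e. $v\mapsto H(v,\cdot)$, is the associated isogeny to the dual abelian variety. The polarisation of an $r$-dimensional abelian variety has type $(e_1,\dots,e_r)$, where the $e_i$ are positive integers with $e_i\mid e_{i+1}$, if $\ker\varphi_{\mathcal L}\cong(\mathbb Z/e_1\times\dots\times\mathbb Z/e_r)^2$. Homomorphisms and isomorphisms are those of complex tori. A primitive $k$-torsion point is a point of exact order $k$. **Theorem.** Let $n\ge 2$ and let $(1,d_2,\dots,d_n)$ be a sequence of positive integers with $d_i\mid d_{i+1}$ for $i=2,\dots,n-1$ and $d_n>1$. Let $E$ be an elliptic curve with a primitive $d_n$-torsion point $P\in E$ such that $E/\langle P\rangle$ is not isomorphic to $E$. Let $(B,\mathcal L_B)$ be a $(d_2,\dots,d_n)$-polarised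 abelian variety with $\operatorname{Hom}(E,B)=0$, and let $Q\in\ker\varphi_{\mathcal L_B}$ be a primitive $d_n$-torsion point. Put $A=(E\times B)/\langle(P,Q)\rangle$. Then $A$ is an abelian variety which carries a polarisation $\mathcal L_A$ of type $(1,d_2,\dots,d_n)$ such that $A=E\boxplus B$ with respect to $\mathcal L_A$, and $A$ is not isomorphic to its dual $\hat A$. Here $A=E\boxplus B$ means that the maps $\iota:E\to A$ and $\kappa:B\to A$ induced by the inclusions into $E\times B$ are injective and that $\kappa(B)$ is the abelian subvariety complementary to $\iota(E)$, i.e. the image of $m(1-\varepsilon_E)\in\operatorname{End}(A)$ for a suitable integer $m\ge1$, where $\varepsilon_E=\iota\,\varphi_{\iota^*\mathcal L_A}^{-1}\,\hat\iota\,\varphi_{\mathcal L_A}\in\operatorname{End}(A)\otimes\mathbb Q$ is the symmetric idempotent of $E$. -/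

import Mathlib

open Filter Topology

universe u v w

noncomputable section

/-- A complex torus `V / Λ`: a finite-dimensional complex vector space `V` together with a lattice
`Λ`, i.e. a discrete subgroup spanning `V` over `ℝ`. The norm on `V` only serves to fix its
(unique) vector space topology. -/
structure ComplexTorus where
  /-- The universal cover. -/
  V : Type u
  [normed : NormedAddCommGroup V]
  [space : NormedSpace ℂ V]
  [finiteDim : FiniteDimensional ℂ V]
  /-- The period lattice. -/
  lattice : Submodule ℤ V
  [discrete : DiscreteTopology lattice]
  [isLattice : IsZLattice ℝ lattice]

namespace ComplexTorus

attribute [instance] ComplexTorus.normed ComplexTorus.space ComplexTorus.finiteDim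
  ComplexTorus.discrete ComplexTorus.isLattice

/-- The group of points of the complex torus. -/
abbrev Pt (X : ComplexTorus.{u}) : Type u := X.V ⧸ X.lattice

/-- The universal covering `V → V / Λ`. -/
abbrev proj (X : ComplexTorus.{u}) : X.V →ₗ[ℤ] X.Pt := X.lattice.mkQ

/-- The complex dimension of a complex torus. -/
def dim (X : ComplexTorus.{u}) : ℕ := Module.finrank ℂ X.V

/-- An elliptic curve is a complex torus of dimension one. -/
def IsEllipticCurve (X : ComplexTorus.{u}) : Prop := X.dim = 1

theorem proj_eq_zero (X : ComplexTorus.{u}) (x : X.V) : X.proj x = 0 ↔ x ∈ X.lattice := by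
  simp [proj]

/-! ### Homomorphisms -/

/-- A group homomorphism between complex tori is holomorphic if locally it lifts
to holomorphic maps between the universal covers (whose local inverses are the charts). -/
def IsHolomorphic {X : ComplexTorus.{u}} {Y : ComplexTorus.{v}} (f : X.Pt →+ Y.Pt) : Prop :=
  ∀ x : X.V, ∃ F : X.V → Y.V,
    ∀ᶠ z in 𝓝 x, DifferentiableAt ℂ F z ∧ Y.proj (F z) = f (X.proj z)

/-- A homomorphism of complex tori: a holomorphic homomorphism of groups. -/
structure Hom (X : ComplexTorus.{u}) (Y : ComplexTorus.{v}) where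
  /-- The underlying homomorphism of groups. -/
  toAddHom : X.Pt →+ Y.Pt
  holomorphic : IsHolomorphic toAddHom

instance (X : ComplexTorus.{u}) (Y : ComplexTorus.{v}) : CoeFun (Hom X Y) fun _ => X.Pt → Y.Pt :=
  ⟨fun f => f.toAddHom⟩

theorem exists_ball_lattice (X : ComplexTorus.{u}) :
    ∃ ε > 0, ∀ x ∈ X.lattice, ‖x‖ < ε → x = 0 := by
  have h : ({0} : Set X.lattice) ∈ 𝓝 (0 : X.lattice) := (isOpen_discrete _).mem_nhds rfl
  obtain ⟨ε, hε, hb⟩ := Metric.mem_nhds_iff.1 h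
  refine ⟨ε, hε, fun x hx hn => ?_⟩
  have : (⟨x, hx⟩ : X.lattice) ∈ ({0} : Set X.lattice) := hb (by simpa using hn)
  simpa using this

/-- Every homomorphism of complex tori is induced by a unique linear map of the universal covers. -/
theorem Hom.existsUnique_lift {X : ComplexTorus.{u}} {Y : ComplexTorus.{v}} (f : Hom X Y) :
    ∃! F : X.V →L[ℂ] Y.V, ∀ x, Y.proj (F x) = f (X.proj x) := by
  obtain ⟨ε, hε, hball⟩ := Y.exists_ball_lattice
  have hsmall : ∀ x : X.V, Tendsto (fun k : ℕ => ((2 : ℂ) ^ k)⁻¹ • x) atTop (𝓝 0) := by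
    intro x
    have h1 : Tendsto (fun k : ℕ => ((2 : ℂ)⁻¹) ^ k) atTop (𝓝 0) :=
      tendsto_pow_atTop_nhds_zero_of_norm_lt_one (by norm_num)
    simpa using h1.smul_const x
  have hpow : ∀ (k : ℕ) (x : X.V), ((2 ^ k : ℕ) : ℕ) • (((2 : ℂ) ^ k)⁻¹ • x) = x := by
    intro k x
    rw [← Nat.cast_smul_eq_nsmul ℂ]
    push_cast
    exact smul_inv_smul₀ (pow_ne_zero k two_ne_zero) x
  have hex : ∃ F : X.V →L[ℂ] Y.V, ∀ x, Y.proj (F x) = f (X.proj x) := by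
    obtain ⟨F, hF⟩ := f.holomorphic 0
    have hF0 := hF.self_of_nhds
    have hF0' : Y.proj (F 0) = 0 := by simpa using hF0.2
    set G : X.V → Y.V := fun z => F z - F 0 with hG
    have hGd : HasFDerivAt G (fderiv ℂ F 0) 0 := hF0.1.hasFDerivAt.sub_const _
    have hGp : ∀ᶠ z in 𝓝 (0 : X.V), Y.proj (G z) = f (X.proj z) ∧ ‖G z‖ < ε / 3 := by
      have hc : Tendsto (fun z => ‖G z‖) (𝓝 0) (𝓝 0) := by
        have := hGd.continuousAt.norm
        simpa [ContinuousAt, hG] using this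
      filter_upwards [hF, hc.eventually (gt_mem_nhds (by positivity : (0 : ℝ) < ε / 3))]
        with z hz hz'
      refine ⟨?_, hz'⟩
      rw [hG, map_sub, hF0', hz.2, sub_zero]
    obtain ⟨δ, hδ, hb⟩ := Metric.eventually_nhds_iff.1 hGp
    have hdouble : ∀ z : X.V, ‖z‖ < δ → G z = (2 : ℂ) • G ((2 : ℂ)⁻¹ • z) := by
      intro z hz
      have hz2 : ‖(2 : ℂ)⁻¹ • z‖ < δ := by
        rw [norm_smul]; norm_num; linarith [norm_nonneg z]
      obtain ⟨a1, a2⟩ := hb (by simpa using hz : dist z 0 < δ)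
      obtain ⟨b1, b2⟩ := hb (by simpa using hz2 : dist ((2 : ℂ)⁻¹ • z) 0 < δ)
      have hmem : G z - (2 : ℂ) • G ((2 : ℂ)⁻¹ • z) ∈ Y.lattice := by
        rw [← proj_eq_zero, map_sub, two_smul, map_add, a1, b1, ← map_add f.toAddHom, ← map_add,
          ← two_smul ℂ ((2 : ℂ)⁻¹ • z), smul_inv_smul₀ (by norm_num), sub_self]
      have := hball _ hmem (by
        refine (norm_sub_le _ _).trans_lt ?_
        rw [norm_smul]; norm_num; linarith)
      exact sub_eq_zero.1 this
    have hdoubles : ∀ (k : ℕ) (z : X.V), ‖z‖ < δ →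
        G z = (2 : ℂ) ^ k • G (((2 : ℂ) ^ k)⁻¹ • z) := by
      intro k
      induction k with
      | zero => intro z _; simp
      | succ k ih =>
        intro z hz
        have hz2 : ‖((2 : ℂ) ^ k)⁻¹ • z‖ < δ := by
          rw [norm_smul]
          have h1 : ‖((2 : ℂ) ^ k)⁻¹‖ ≤ 1 := by
            rw [norm_inv, norm_pow]; norm_num
            exact inv_le_one_of_one_le₀ (one_le_pow₀ (by norm_num))
          nlinarith [norm_nonneg z]
        rw [ih z hz, hdouble _ hz2, smul_smul, smul_smul, pow_succ, mul_inv, mul_comm (2 : ℂ)⁻¹]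
    have hlin : ∀ z : X.V, ‖z‖ < δ → G z = fderiv ℂ F 0 z := by
      intro z hz
      have hl := hGd.lim z (c := fun k : ℕ => (2 : ℂ) ^ k) (l := atTop) (by
        simpa using tendsto_pow_atTop_atTop_of_one_lt (r := (2 : ℝ)) (by norm_num))
      have hl' : Tendsto (fun _ : ℕ => G z) atTop (𝓝 (fderiv ℂ F 0 z)) := by
        refine hl.congr fun k => ?_
        have h0 : G 0 = 0 := by simp [hG]
        rw [zero_add, h0, sub_zero, ← hdoubles k z hz]
      exact tendsto_nhds_unique tendsto_const_nhds hl'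
    refine ⟨fderiv ℂ F 0, fun x => ?_⟩
    obtain ⟨k, hk⟩ := ((hsmall x).eventually (Metric.ball_mem_nhds 0 hδ)).exists
    have hk' : ‖((2 : ℂ) ^ k)⁻¹ • x‖ < δ := by simpa using hk
    have h1 := (hb (by simpa using hk' : dist (((2 : ℂ) ^ k)⁻¹ • x) 0 < δ)).1
    rw [hlin _ hk'] at h1
    conv_lhs => rw [← hpow k x]
    conv_rhs => rw [← hpow k x]
    rw [map_nsmul, map_nsmul, map_nsmul, h1]
    exact (map_nsmul f.toAddHom _ _).symm
  obtain ⟨F, hF⟩ := hex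
  refine ⟨F, hF, fun F' hF' => ?_⟩
  ext x
  have hmem : ∀ z, (F' - F) z ∈ Y.lattice := by
    intro z
    have h := (hF' z).trans (hF z).symm
    rw [← proj_eq_zero, sub_apply, map_sub, h, sub_self]
  have hc : Tendsto (fun k : ℕ => ‖(F' - F) (((2 : ℂ) ^ k)⁻¹ • x)‖) atTop (𝓝 0) := by
    simpa only [map_zero, norm_zero, Function.comp_def] using
      (((F' - F).continuous.tendsto 0).comp (hsmall x)).norm
  obtain ⟨k, hk⟩ := (hc.eventually (gt_mem_nhds hε)).exists
  have h0 := hball _ (hmem _) hk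
  have h1 : (F' - F) x = 0 := by
    rw [← hpow k x, map_nsmul, h0, smul_zero]
  exact sub_eq_zero.1 h1

/-- The analytic representation of a homomorphism: the unique linear map of the universal covers
that induces it. -/
def Hom.rep {X : ComplexTorus.{u}} {Y : ComplexTorus.{v}} (f : Hom X Y) : X.V →L[ℂ] Y.V :=
  f.existsUnique_lift.choose

theorem Hom.proj_rep {X : ComplexTorus.{u}} {Y : ComplexTorus.{v}} (f : Hom X Y) (x : X.V) :
    Y.proj (f.rep x) = f (X.proj x) :=
  f.existsUnique_lift.choose_spec.1 x

theorem Hom.rep_mem {X : ComplexTorus.{u}} {Y : ComplexTorus.{v}} (f : Hom X Y) {x : X.V}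
    (hx : x ∈ X.lattice) : f.rep x ∈ Y.lattice := by
  rw [← proj_eq_zero, f.proj_rep, (X.proj_eq_zero x).2 hx]
  exact map_zero f.toAddHom

/-- The homomorphism of complex tori induced by a linear map which respects the lattices. -/
def Hom.ofLinear {X : ComplexTorus.{u}} {Y : ComplexTorus.{v}} (F : X.V →L[ℂ] Y.V)
    (hF : ∀ x ∈ X.lattice, F x ∈ Y.lattice) : Hom X Y where
  toAddHom := (X.lattice.mapQ Y.lattice (F.toLinearMap.restrictScalars ℤ) hF).toAddMonoidHom
  holomorphic _ := ⟨F, Eventually.of_forall fun _ => ⟨F.differentiableAt, rfl⟩⟩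

/-- Composition of homomorphisms (first `f`, then `g`). -/
def Hom.comp {X : ComplexTorus.{u}} {Y : ComplexTorus.{v}} {Z : ComplexTorus.{w}}
    (g : Hom Y Z) (f : Hom X Y) : Hom X Z where
  toAddHom := g.toAddHom.comp f.toAddHom
  holomorphic _ := ⟨g.rep ∘ f.rep, Eventually.of_forall fun z =>
    ⟨g.rep.differentiableAt.comp z f.rep.differentiableAt, by
      simp only [Function.comp_apply, g.proj_rep, f.proj_rep, AddMonoidHom.comp_apply]⟩⟩

/-- Two complex tori are isomorphic if there are mutually inverse homomorphisms between them. -/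
def Isomorphic (X : ComplexTorus.{u}) (Y : ComplexTorus.{v}) : Prop :=
  ∃ (f : Hom X Y) (g : Hom Y X), (∀ x, g (f x) = x) ∧ ∀ y, f (g y) = y

/-! ### Products and quotients -/

instance discrete_prod (X : ComplexTorus.{u}) (Y : ComplexTorus.{v}) :
    DiscreteTopology (X.lattice.prod Y.lattice) := by
  refine DiscreteTopology.of_continuous_injective
    (f := fun z : X.lattice.prod Y.lattice =>
      ((⟨z.1.1, z.2.1⟩, ⟨z.1.2, z.2.2⟩) : X.lattice × Y.lattice)) (by fun_prop) ?_
  intro a b h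
  have h1 := congrArg (fun t => (t.1 : X.V)) h
  have h2 := congrArg (fun t => (t.2 : Y.V)) h
  exact Subtype.ext (Prod.ext h1 h2)

instance isZLattice_prod (X : ComplexTorus.{u}) (Y : ComplexTorus.{v}) :
    IsZLattice ℝ (X.lattice.prod Y.lattice) := by
  constructor
  rw [Submodule.eq_top_iff']
  rintro ⟨x, y⟩
  have hx : x ∈ Submodule.span ℝ (X.lattice : Set X.V) := by
    rw [IsZLattice.span_top]; trivial
  have hy : y ∈ Submodule.span ℝ (Y.lattice : Set Y.V) := by
    rw [IsZLattice.span_top]; trivial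
  have h1 : (x, (0 : Y.V)) ∈
      Submodule.span ℝ ((X.lattice.prod Y.lattice : Submodule ℤ (X.V × Y.V)) : Set _) := by
    have := Submodule.mem_map_of_mem (f := LinearMap.inl ℝ X.V Y.V) hx
    rw [Submodule.map_span] at this
    refine Submodule.span_mono ?_ this
    rintro _ ⟨z, hz, rfl⟩
    exact ⟨hz, Y.lattice.zero_mem⟩
  have h2 : ((0 : X.V), y) ∈
      Submodule.span ℝ ((X.lattice.prod Y.lattice : Submodule ℤ (X.V × Y.V)) : Set _) := by
    have := Submodule.mem_map_of_mem (f := LinearMap.inr ℝ X.V Y.V) hy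
    rw [Submodule.map_span] at this
    refine Submodule.span_mono ?_ this
    rintro _ ⟨z, hz, rfl⟩
    exact ⟨X.lattice.zero_mem, hz⟩
  simpa using Submodule.add_mem _ h1 h2

/-- The product of two complex tori. -/
def prod (X : ComplexTorus.{u}) (Y : ComplexTorus.{v}) : ComplexTorus.{max u v} where
  V := X.V × Y.V
  lattice := X.lattice.prod Y.lattice

/-- The inclusion `X → X × Y`, `x ↦ (x, 0)`. -/
def inl (X : ComplexTorus.{u}) (Y : ComplexTorus.{v}) : Hom X (X.prod Y) :=
  Hom.ofLinear (Y := X.prod Y) (ContinuousLinearMap.inl ℂ X.V Y.V)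
    fun _ hx => ⟨hx, Y.lattice.zero_mem⟩

/-- The inclusion `Y → X × Y`, `y ↦ (0, y)`. -/
def inr (X : ComplexTorus.{u}) (Y : ComplexTorus.{v}) : Hom Y (X.prod Y) :=
  Hom.ofLinear (Y := X.prod Y) (ContinuousLinearMap.inr ℂ X.V Y.V)
    fun _ hy => ⟨X.lattice.zero_mem, hy⟩

/-- The point `(x, y)` of `X × Y`. -/
def pair {X : ComplexTorus.{u}} {Y : ComplexTorus.{v}} (x : X.Pt) (y : Y.Pt) : (X.prod Y).Pt :=
  inl X Y x + inr X Y y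

instance discrete_quotient (X : ComplexTorus.{u}) (G : AddSubgroup X.Pt) [Finite G] :
    DiscreteTopology ((AddSubgroup.toIntSubmodule G).comap X.proj) := by
  have hmem : ∀ z : (AddSubgroup.toIntSubmodule G).comap X.proj,
      ((Nat.card G : ℂ) • (z : X.V)) ∈ X.lattice := by
    intro z
    rw [← proj_eq_zero, Nat.cast_smul_eq_nsmul, map_nsmul]
    have h : Nat.card G • (⟨X.proj z, z.2⟩ : G) = 0 := card_nsmul_eq_zero'
    exact congrArg Subtype.val h
  have hcard : (Nat.card G : ℂ) ≠ 0 := by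
    exact_mod_cast (Nat.card_pos (α := G)).ne'
  refine DiscreteTopology.of_continuous_injective
    (f := fun z : (AddSubgroup.toIntSubmodule G).comap X.proj =>
      (⟨(Nat.card G : ℂ) • (z : X.V), hmem z⟩ : X.lattice)) (by fun_prop) ?_
  intro a b h
  rw [Subtype.mk.injEq] at h
  exact Subtype.ext (smul_right_injective _ hcard h)

instance isZLattice_quotient (X : ComplexTorus.{u}) (G : AddSubgroup X.Pt) [Finite G] :
    IsZLattice ℝ ((AddSubgroup.toIntSubmodule G).comap X.proj) := by
  constructor
  refine top_le_iff.1 ?_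
  rw [← IsZLattice.span_top (K := ℝ) (L := X.lattice)]
  refine Submodule.span_mono fun x hx => ?_
  have h : X.proj x = 0 := (X.proj_eq_zero x).2 hx
  simp only [Submodule.comap_coe, Set.mem_preimage, h]
  exact G.zero_mem

/-- The quotient `X / G` of a complex torus by a finite subgroup; its lattice is the preimage of
`G` in the universal cover of `X`. -/
def quotient (X : ComplexTorus.{u}) (G : AddSubgroup X.Pt) (hG : Finite G) : ComplexTorus.{u} where
  V := X.V
  lattice := (AddSubgroup.toIntSubmodule G).comap X.proj

/-- The quotient homomorphism `X → X / G`. -/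
def quotientMap (X : ComplexTorus.{u}) (G : AddSubgroup X.Pt) (hG : Finite G) :
    Hom X (X.quotient G hG) :=
  Hom.ofLinear (Y := X.quotient G hG) (ContinuousLinearMap.id ℂ X.V) fun x hx => by
    change X.proj x ∈ G
    rw [(X.proj_eq_zero x).2 hx]
    exact G.zero_mem

theorem finite_zmultiples_of_addOrderOf {X : ComplexTorus.{u}} {x : X.Pt} {k : ℕ}
    (hx : addOrderOf x = k) (hk : 1 < k) : Finite (AddSubgroup.zmultiples x) := by
  exact (finite_zmultiples.2 (addOrderOf_pos_iff.1 (by lia))).to_subtype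

theorem finite_zmultiples_pair {X : ComplexTorus.{u}} {Y : ComplexTorus.{v}} {x : X.Pt} {y : Y.Pt}
    {k : ℕ} (hx : addOrderOf x = k) (hy : addOrderOf y = k) (hk : 1 < k) :
    Finite (AddSubgroup.zmultiples (pair x y)) := by
  have h1 : IsOfFinAddOrder x := addOrderOf_pos_iff.1 (by lia)
  have h2 : IsOfFinAddOrder y := addOrderOf_pos_iff.1 (by lia)
  exact (finite_zmultiples.2 (((inl X Y).toAddHom.isOfFinAddOrder h1).add
    ((inr X Y).toAddHom.isOfFinAddOrder h2))).to_subtype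

/-! ### The dual torus -/

instance finiteDimensional_antidual (X : ComplexTorus.{u}) :
    FiniteDimensional ℂ (X.V →L⋆[ℂ] ℂ) := by
  let b := Module.finBasis ℂ X.V
  let φ : (X.V →L⋆[ℂ] ℂ) →ₗ[ℂ] (Fin (Module.finrank ℂ X.V) → ℂ) :=
    { toFun := fun l i => l (b i)
      map_add' := fun _ _ => rfl
      map_smul' := fun _ _ => rfl }
  refine Module.Finite.of_injective φ fun l l' h => ?_
  have h' : l.toLinearMap = l'.toLinearMap := b.ext fun i => congrFun h i
  ext x
  exact LinearMap.congr_fun h' x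

/-- The dual lattice: the antilinear functionals `l` on `V` such that `Im l` takes integral values
on the lattice. -/
def dualLattice (X : ComplexTorus.{u}) : Submodule ℤ (X.V →L⋆[ℂ] ℂ) where
  carrier := {l | ∀ x ∈ X.lattice, ∃ k : ℤ, (l x).im = k}
  zero_mem' _ _ := ⟨0, by simp⟩
  add_mem' := by
    intro l l' hl hl' x hx
    obtain ⟨k, hk⟩ := hl x hx
    obtain ⟨k', hk'⟩ := hl' x hx
    exact ⟨k + k', by simp [hk, hk']⟩
  smul_mem' := by
    intro m l hl x hx
    obtain ⟨k, hk⟩ := hl x hx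
    exact ⟨m * k, by simp [hk]⟩

theorem antilinear_re {X : ComplexTorus.{u}} (l : X.V →L⋆[ℂ] ℂ) (x : X.V) :
    (l x).re = -(l (Complex.I • x)).im := by
  simp

/-- The antilinear functional whose imaginary part is a given real functional. -/
theorem exists_antilinear (X : ComplexTorus.{u}) (α : X.V →ₗ[ℝ] ℝ) :
    ∃ l : X.V →L⋆[ℂ] ℂ, ∀ x, (l x).im = α x := by
  let l : X.V →ₗ⋆[ℂ] ℂ :=
    { toFun := fun x => ⟨-α (Complex.I • x), α x⟩
      map_add' := fun x y => by
        apply Complex.ext <;> simp [add_comm]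
      map_smul' := fun c x => by
        have hc : c • x = c.re • x + c.im • (Complex.I • x) := by
          conv_lhs => rw [← Complex.re_add_im c]
          rw [add_smul, mul_smul, Complex.coe_smul, Complex.coe_smul]
        have hI : Complex.I • (Complex.I • x) = -x := by
          rw [smul_smul, Complex.I_mul_I, neg_one_smul]
        have h2 : Complex.I • c • x = c.re • (Complex.I • x) - c.im • x := by
          rw [hc, smul_add, smul_comm Complex.I c.re, smul_comm Complex.I c.im, hI, smul_neg,
            sub_eq_add_neg]
        rw [h2, hc]
        apply Complex.ext <;>
          simp only [map_add, map_sub, map_smul, smul_eq_mul, Complex.mul_re, Complex.mul_im,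
            Complex.conj_re, Complex.conj_im] <;> ring }
  have hl : Continuous l :=
    LinearMap.continuous_of_finiteDimensional (𝕜 := ℝ)
      { toFun := l, map_add' := l.map_add, map_smul' := fun c x => by
          have := l.map_smulₛₗ (c : ℂ) x
          simpa using this }
  exact ⟨⟨l, hl⟩, fun _ => rfl⟩

/-- The dual lattice is discrete. -/
instance discrete_dual (X : ComplexTorus.{u}) :
    DiscreteTopology (X.dualLattice) := by
  let ι := Module.Free.ChooseBasisIndex ℤ X.lattice
  let b := (Module.Free.chooseBasis ℤ X.lattice).ofZLatticeBasis ℝ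
  have hb : ∀ i, b i ∈ X.lattice := fun i => by simp [b]
  choose k hk using fun (l : X.dualLattice) (i : ι) => l.2 (b i) (hb i)
  refine DiscreteTopology.of_continuous_injective (f := k) ?_ ?_
  · refine continuous_pi fun i => ?_
    rw [Int.isClosedEmbedding_coe_real.isInducing.continuous_iff]
    have : (Int.cast ∘ fun l => k l i : X.dualLattice → ℝ) = fun l => (l.1 (b i)).im :=
      funext fun l => (hk l i).symm
    rw [this]
    exact Complex.continuous_im.comp
      ((continuous_eval_const (b i)).comp continuous_subtype_val)
  · intro l l' h
    have him : ∀ x, (l.1 x).im = (l'.1 x).im := by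
      let α : (X.V →L⋆[ℂ] ℂ) → X.V →ₗ[ℝ] ℝ := fun m =>
        { toFun := fun x => (m x).im
          map_add' := fun x y => by simp
          map_smul' := fun c x => by
            have := m.map_smulₛₗ (c : ℂ) x
            rw [← Complex.coe_smul c x, this]
            simp }
      have : α l.1 = α l'.1 := b.ext fun i => by
        change (l.1 (b i)).im = (l'.1 (b i)).im
        rw [hk, hk, h]
      exact fun x => LinearMap.congr_fun this x
    refine Subtype.ext (ContinuousLinearMap.ext fun x => Complex.ext ?_ (him x))
    rw [antilinear_re, antilinear_re, him]

/-- The dual lattice spans over `ℝ`. -/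
instance isZLattice_dual (X : ComplexTorus.{u}) :
    IsZLattice ℝ (X.dualLattice) := by
  constructor
  rw [Submodule.eq_top_iff']
  intro l
  let b := (Module.Free.chooseBasis ℤ X.lattice).ofZLatticeBasis ℝ
  choose m hm using fun i => X.exists_antilinear (b.coord i)
  have hmem : ∀ i, m i ∈ X.dualLattice := by
    intro i x hx
    refine ⟨(Module.Free.chooseBasis ℤ X.lattice).repr ⟨x, hx⟩ i, ?_⟩
    rw [hm, Module.Basis.coord_apply]
    exact Module.Basis.ofZLatticeBasis_repr_apply ℝ X.lattice _ ⟨x, hx⟩ i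
  have him : ∀ x, (l x).im = ((∑ i, (l (b i)).im • m i) x).im := by
    intro x
    have hx : l x = ∑ i, ((b.repr x i : ℝ) : ℂ) * l (b i) := by
      conv_lhs => rw [← b.sum_repr x]
      rw [map_sum]
      refine Finset.sum_congr rfl fun i _ => ?_
      rw [← Complex.coe_smul, l.map_smulₛₗ]
      simp
    have h2 : (∑ i, (l (b i)).im • m i) x = ∑ i, (l (b i)).im • m i x := by
      simp
    rw [hx, h2, Complex.im_sum, Complex.im_sum]
    refine Finset.sum_congr rfl fun i _ => ?_
    rw [Complex.smul_im, hm, Complex.im_ofReal_mul, smul_eq_mul, mul_comm]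
    rfl
  have hl : l = ∑ i, (l (b i)).im • m i := by
    refine ContinuousLinearMap.ext fun x => Complex.ext ?_ (him x)
    rw [antilinear_re, antilinear_re, him]
  rw [hl]
  exact Submodule.sum_mem _ fun i _ => Submodule.smul_mem _ _ (Submodule.subset_span (hmem i))

/-- The dual torus `Hom_antilinear(V, ℂ) / Λ^`. -/
def dual (X : ComplexTorus.{u}) : ComplexTorus.{u} where
  V := X.V →L⋆[ℂ] ℂ
  lattice := X.dualLattice

/-- The dual homomorphism `Y^ → X^` of `f : X → Y`, induced by `l ↦ l ∘ F`, where `F` is the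
analytic representation of `f`. -/
def Hom.dual {X : ComplexTorus.{u}} {Y : ComplexTorus.{v}} (f : Hom X Y) : Hom Y.dual X.dual :=
  Hom.ofLinear (X := Y.dual) (Y := X.dual) (ContinuousLinearMap.precomp ℂ f.rep)
    fun _ hl x hx => hl (f.rep x) (f.rep_mem hx)

/-! ### Polarisations -/

/-- An element of the Néron–Severi group of `X`, i.e. the first Chern class of a line bundle: a
Hermitian form on the universal cover whose imaginary part is integral on the lattice. The form is
linear in the first and antilinear in the second variable. -/
structure NeronSeveri (X : ComplexTorus.{u}) where
  /-- The Hermitian form. -/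
  form : X.V →L[ℂ] (X.V →L⋆[ℂ] ℂ)
  hermitian : ∀ x y, form y x = (starRingEnd ℂ) (form x y)
  integral : ∀ x ∈ X.lattice, ∀ y ∈ X.lattice, ∃ k : ℤ, (form x y).im = k

namespace NeronSeveri

/-- A class is a polarisation (the class of an ample line bundle) if its Hermitian form is positive
definite. -/
def IsPolarisation {X : ComplexTorus.{u}} (L : NeronSeveri X) : Prop :=
  ∀ x, x ≠ 0 → 0 < (L.form x x).re

/-- The homomorphism `φ_L : X → X^`, given by `x ↦ t_x^* L ⊗ L⁻¹`; its analytic representation is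
`x ↦ H(x, ·)`. -/
def phi {X : ComplexTorus.{u}} (L : NeronSeveri X) : Hom X X.dual :=
  Hom.ofLinear (Y := X.dual) L.form L.integral

/-- `L` has type `(d_1, …, d_n)`: here `n = dim X`, the `d_i` are positive integers with
`d_i ∣ d_{i+1}`, and `ker φ_L ≃ (ℤ/d_1 × ⋯ × ℤ/d_n)²`. -/
def HasType {X : ComplexTorus.{u}} (L : NeronSeveri X) {n : ℕ} (d : Fin n → ℕ) : Prop :=
  X.dim = n ∧ (∀ i, 0 < d i) ∧ (∀ i j, i ≤ j → d i ∣ d j) ∧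
    Nonempty (L.phi.toAddHom.ker ≃+ (∀ i, ZMod (d i)) × (∀ i, ZMod (d i)))

/-- The pullback `f^* L`. -/
def pullback {X : ComplexTorus.{u}} {Y : ComplexTorus.{v}} (f : Hom X Y) (L : NeronSeveri Y) :
    NeronSeveri X where
  form := (ContinuousLinearMap.precomp ℂ f.rep).comp (L.form.comp f.rep)
  hermitian _ _ := L.hermitian _ _
  integral _ hx _ hy := L.integral _ (f.rep_mem hx) _ (f.rep_mem hy)

/-- `X = Y ⊞ Z` with respect to the polarisation `L`: the homomorphisms `ι : Y → X` and
`κ : Z → X` are embeddings of abelian subvarieties, and `Z` is complementary to `Y`. The symmetric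
idempotent of `Y` is `ε_Y = ι φ_{ι^*L}⁻¹ ι^ φ_L ∈ End(X) ⊗ ℚ`; some positive multiple
`m ε_Y = ι ∘ f` is an endomorphism, i.e. `φ_{ι^*L} ∘ f = m ι^ ∘ φ_L` for some `f : X → Y`, and the
complementary subvariety is the image of `m (1 - ε_Y)`. -/
def IsComplementary {X : ComplexTorus.{u}} {Y : ComplexTorus.{v}} {Z : ComplexTorus.{w}}
    (L : NeronSeveri X) (ι : Hom Y X) (κ : Hom Z X) : Prop :=
  Function.Injective ι ∧ Function.Injective κ ∧
    ∃ (m : ℕ) (f : Hom X Y), 0 < m ∧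
      (∀ x, (L.pullback ι).phi (f x) = m • ι.dual (L.phi x)) ∧
      Set.range κ = Set.range fun x => m • x - ι (f x)

end NeronSeveri

end ComplexTorus

end

/-! Write `d` for the largest entry of the type, `p`, `q` for lifts of `P`, `Q`, and `Λ_A` for the
lattice of `A`, generated by `Λ_E × Λ_B` and `(p, q)`.

Polarisation: take `H_E` principal on `E` and put `d H_E ⊞ H_B` on `A`. It is integral on `Λ_A`
since `d p ∈ Λ_E`, `Q ∈ ker φ_B` and alternating forms vanish on the diagonal. Its kernel is `⟨(P,
Q)⟩^⊥ / ⟨(P, Q)⟩` inside `E[d] × ker φ_B`. As `H_E` is principal, some `e ∈ Λ_E` satisfies `d Im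
H_E(p, e) ≡ 1 mod d` (`IsPrincipal.exists_dual_vector`). The real-linear, non-holomorphic map `y ↦
(-Im H_B(q, y) e, y)` corrects each point of `ker φ_B` by a torsion point of `E` so that it becomes
orthogonal to `(P, Q)`; it induces `ker φ_B ≃ ker φ_A` (`nonempty_kernel_equiv`), which gives the
type. The sum being orthogonal, the symmetric idempotent of `E` is the first projection, whence `A =
E ⊞ B`.

Not self-dual: the projection `A → E/⟨P⟩` dualises to an embedding of `(E/⟨P⟩)^` into `Â`. Under an
isomorphism `Â ≃ A` its image has no component along `B`, because `(E/⟨P⟩)^` is isogenous to `E` and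
`Hom(E, B) = 0`; so it is identified with `E ⊂ A`. Elliptic curves being self-dual, `E/⟨P⟩ ≃ E`,
which is excluded (`isomorphic_quotient_of_isomorphic_dual`). -/

noncomputable section

namespace ComplexTorus

/-! ### Homomorphisms through their analytic representations -/

theorem Hom.rep_eq {X : ComplexTorus.{u}} {Y : ComplexTorus.{v}} (f : Hom X Y) (F : X.V →L[ℂ] Y.V)
    (hF : ∀ x, Y.proj (F x) = f (X.proj x)) : f.rep = F :=
  f.existsUnique_lift.unique f.proj_rep hF

theorem Hom.rep_ofLinear {X : ComplexTorus.{u}} {Y : ComplexTorus.{v}} (F : X.V →L[ℂ] Y.V)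
    (hF : ∀ x ∈ X.lattice, F x ∈ Y.lattice) : (Hom.ofLinear F hF).rep = F :=
  Hom.rep_eq _ _ fun _ => rfl

theorem Hom.rep_comp {X : ComplexTorus.{u}} {Y : ComplexTorus.{v}} {Z : ComplexTorus.{w}}
    (g : Hom Y Z) (f : Hom X Y) : (g.comp f).rep = g.rep.comp f.rep :=
  Hom.rep_eq _ _ fun x => by
    rw [ContinuousLinearMap.comp_apply, g.proj_rep, f.proj_rep]
    rfl

theorem proj_surjective (X : ComplexTorus.{u}) : Function.Surjective X.proj :=
  X.lattice.mkQ_surjective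

theorem proj_eq_proj (X : ComplexTorus.{u}) {x y : X.V} :
    X.proj x = X.proj y ↔ x - y ∈ X.lattice := by
  rw [← proj_eq_zero, map_sub, sub_eq_zero]

theorem Hom.injective_of_rep {X : ComplexTorus.{u}} {Y : ComplexTorus.{v}} (f : Hom X Y)
    (h : ∀ x, f.rep x ∈ Y.lattice → x ∈ X.lattice) : Function.Injective f := by
  refine (injective_iff_map_eq_zero f.toAddHom).2 fun a ha => ?_
  obtain ⟨x, rfl⟩ := X.proj_surjective a
  rw [proj_eq_zero]
  apply h
  rw [← proj_eq_zero, f.proj_rep]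
  exact ha

/-- A linear isomorphism of the universal covers that matches the lattices induces an isomorphism
of complex tori. -/
theorem isomorphic_of_linearEquiv {X : ComplexTorus.{u}} {Y : ComplexTorus.{v}}
    (F : X.V ≃ₗ[ℂ] Y.V) (hF : ∀ x, F x ∈ Y.lattice ↔ x ∈ X.lattice) : Isomorphic X Y := by
  let F' := F.toContinuousLinearEquiv
  refine ⟨Hom.ofLinear (F' : X.V →L[ℂ] Y.V) fun x hx => (hF x).2 hx,
    Hom.ofLinear (F'.symm : Y.V →L[ℂ] X.V) fun y hy => (hF _).1 ?_, fun x => ?_, fun y => ?_⟩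
  · simpa [F'] using hy
  · obtain ⟨x, rfl⟩ := X.proj_surjective x
    exact congrArg X.proj (F'.symm_apply_apply x)
  · obtain ⟨y, rfl⟩ := Y.proj_surjective y
    exact congrArg Y.proj (F'.apply_symm_apply y)

theorem Isomorphic.exists_linearEquiv {X : ComplexTorus.{u}} {Y : ComplexTorus.{v}}
    (h : Isomorphic X Y) :
    ∃ F : X.V ≃ₗ[ℂ] Y.V, ∀ x, F x ∈ Y.lattice ↔ x ∈ X.lattice := by
  obtain ⟨f, g, hgf, hfg⟩ := h
  have h1 : (g.comp f).rep = ContinuousLinearMap.id ℂ X.V := Hom.rep_eq _ _ fun x => (hgf _).symm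
  have h2 : (f.comp g).rep = ContinuousLinearMap.id ℂ Y.V := Hom.rep_eq _ _ fun x => (hfg _).symm
  rw [Hom.rep_comp] at h1 h2
  have h1' : ∀ x, g.rep (f.rep x) = x := fun x => DFunLike.congr_fun h1 x
  have h2' : ∀ x, f.rep (g.rep x) = x := fun x => DFunLike.congr_fun h2 x
  refine ⟨LinearEquiv.ofLinearMap f.rep.toLinearMap g.rep.toLinearMap (LinearMap.ext h2')
    (LinearMap.ext h1'), fun x => ⟨fun hx => ?_, fun hx => f.rep_mem hx⟩⟩
  have := g.rep_mem hx
  rw [LinearEquiv.coe_ofLinearMap] at this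
  change g.rep (f.rep x) ∈ X.lattice at this
  rwa [h1'] at this

/-- A linear map of the universal covers which maps the lattice of `X` into a multiple
`n⁻¹ Λ` of the lattice of `Y` vanishes if there are no nontrivial homomorphisms. -/
theorem eq_zero_of_hom_eq_zero {X : ComplexTorus.{u}} {Y : ComplexTorus.{v}}
    (h : ∀ (f : Hom X Y) (x : X.Pt), f x = 0) (F : X.V →L[ℂ] Y.V) (n : ℕ) (hn : n ≠ 0)
    (hF : ∀ x ∈ X.lattice, n • F x ∈ Y.lattice) : F = 0 := by
  have h1 := Hom.rep_ofLinear (X := X) (Y := Y) (n • F) hF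
  have h2 : (Hom.ofLinear (X := X) (Y := Y) (n • F) hF).rep = 0 :=
    Hom.rep_eq _ _ fun x => by rw [h]; exact map_zero _
  rw [h2] at h1
  rw [← Nat.cast_smul_eq_nsmul ℂ] at h1
  exact (smul_eq_zero.1 h1.symm).resolve_left (by exact_mod_cast hn)

/-! ### Hermitian forms and self-duality of elliptic curves -/

namespace NeronSeveri

theorem im_form_swap {X : ComplexTorus.{u}} (L : NeronSeveri X) (x y : X.V) :
    (L.form y x).im = -(L.form x y).im := by
  rw [L.hermitian x y, Complex.conj_im]

theorem im_form_self {X : ComplexTorus.{u}} (L : NeronSeveri X) (x : X.V) :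
    (L.form x x).im = 0 := by
  have := L.im_form_swap x x
  linarith

theorem phi_proj_eq_zero {X : ComplexTorus.{u}} (L : NeronSeveri X) (x : X.V) :
    L.phi (X.proj x) = 0 ↔ ∀ y ∈ X.lattice, ∃ k : ℤ, (L.form x y).im = k :=
  X.dual.proj_eq_zero (L.form x)

/-- On an elliptic curve any alternating form satisfies the two-dimensional Cramer identity. -/
theorem cramer {X : ComplexTorus.{u}} (hX : X.IsEllipticCurve) (L : NeronSeveri X)
    (x y z : X.V) :
    ((L.form x y).im : ℂ) • z = ((L.form z y).im : ℂ) • x + ((L.form x z).im : ℂ) • y := by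
  obtain ⟨v, hv, hs⟩ := finrank_eq_one_iff'.1 hX
  obtain ⟨a, rfl⟩ := hs x
  obtain ⟨b, rfl⟩ := hs y
  obtain ⟨c, rfl⟩ := hs z
  have him := L.im_form_self v
  -- In a complex coordinate `Im H` is a real multiple of the determinant `Im (a * conj b)`, so only
  -- an identity between complex numbers remains.
  have hab : ∀ a b : ℂ, (L.form (a • v) (b • v)).im
      = (a.im * b.re - a.re * b.im) * (L.form v v).re := by
    intro a b
    rw [L.form.map_smul, smul_apply, (L.form v).map_smulₛₗ]
    simp [him]
    ring
  simp only [hab, smul_smul, ← add_smul]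
  congr 1
  apply Complex.ext <;> simp <;> ring

/-- A principal class: `φ_L` is injective. -/
def IsPrincipal {X : ComplexTorus.{u}} (L : NeronSeveri X) : Prop :=
  ∀ x, (∀ y ∈ X.lattice, ∃ k : ℤ, (L.form x y).im = k) → x ∈ X.lattice

end NeronSeveri

/-- Every elliptic curve carries a principal polarisation. -/
theorem IsEllipticCurve.exists_principal {X : ComplexTorus.{u}} (hX : X.IsEllipticCurve) :
    ∃ L : NeronSeveri X, L.IsPolarisation ∧ L.IsPrincipal := by
  have hrank : Module.finrank ℤ X.lattice = 2 := by
    rw [ZLattice.rank ℝ X.lattice, finrank_real_of_complex]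
    have : Module.finrank ℂ X.V = 1 := hX
    rw [this]
  let b0 : Module.Basis (Fin 2) ℤ X.lattice := Module.finBasisOfFinrankEq ℤ X.lattice hrank
  let b := b0.ofZLatticeBasis ℝ
  have hbmem : ∀ i, b i ∈ X.lattice := fun i => by simp [b]
  let c : X.V ≃L[ℂ] ℂ := ContinuousLinearEquiv.ofFinrankEq (by
    rw [Module.finrank_self]; exact hX)
  have hcr : ∀ (r : ℝ) (x : X.V), c (r • x) = r * c x := fun r x => by
    rw [← Complex.coe_smul, map_smul, smul_eq_mul]
  set D : ℝ := (c (b 0) * (starRingEnd ℂ) (c (b 1))).im with hDdef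
  -- If `D = 0`, then `c (b 0) * conj (c (b 1))` is a real number `r`; multiplying by `c (b 1)`
  -- gives a real linear relation between `b 0` and `b 1`.
  have hD : D ≠ 0 := by
    intro h0
    set r := (c (b 0) * (starRingEnd ℂ) (c (b 1))).re with hr
    have h1 : c (b 0) * (starRingEnd ℂ) (c (b 1)) = r :=
      Complex.ext (by simp [hr]) (by rw [← hDdef, h0, Complex.ofReal_im])
    have h2 : Complex.normSq (c (b 1)) • b 0 + (-r) • b 1 = 0 := by
      apply c.injective
      rw [map_add, hcr, hcr, map_zero c, Complex.normSq_eq_conj_mul_self, Complex.ofReal_neg, ← h1]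
      ring
    have h3 : Complex.normSq (c (b 1)) = 0 := by
      have h4 := congrArg (fun x => b.repr x 0) h2
      simpa using h4
    exact b.ne_zero 1 (c.map_eq_zero_iff.1 (Complex.normSq_eq_zero.1 h3))
  let cbar : X.V →L⋆[ℂ] ℂ := ((starL ℂ : ℂ ≃L⋆[ℂ] ℂ) : ℂ →L⋆[ℂ] ℂ).comp (c : X.V →L[ℂ] ℂ)
  -- Dividing by `|D|` rather than `D` keeps the form positive; the price is that `Im H (b 0) (b 1)`
  -- is the sign `σ` of `D` instead of `1`.
  let H : X.V →L[ℂ] (X.V →L⋆[ℂ] ℂ) :=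
    (((|D|⁻¹ : ℝ) : ℂ) • (c : X.V →L[ℂ] ℂ)).smulRight cbar
  have hH : ∀ x y, H x y = ((|D|⁻¹ : ℝ) : ℂ) * c x * (starRingEnd ℂ) (c y) := fun _ _ => rfl
  have hHb : ∀ s0 s1 t0 t1 : ℝ, (H (s0 • b 0 + s1 • b 1) (t0 • b 0 + t1 • b 1)).im
      = |D|⁻¹ * D * (s0 * t1 - s1 * t0) := by
    intro s0 s1 t0 t1
    rw [hH, map_add, map_add, hcr, hcr, hcr, hcr, mul_assoc, Complex.im_ofReal_mul, hDdef]
    simp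
    ring
  have hexp : ∀ x, x = b.repr x 0 • b 0 + b.repr x 1 • b 1 := fun x => by
    conv_lhs => rw [← b.sum_repr x]
    rw [Fin.sum_univ_two]
  obtain ⟨σ, hσ, hσ2⟩ : ∃ σ : ℤ, |D|⁻¹ * D = σ ∧ σ * σ = 1 := by
    rcases abs_choice D with h | h <;> rw [h]
    · exact ⟨1, by rw [inv_mul_cancel₀ hD]; simp, rfl⟩
    · exact ⟨-1, by rw [inv_neg, neg_mul, inv_mul_cancel₀ hD]; simp, rfl⟩
  have hint : ∀ x ∈ X.lattice, ∃ k : Fin 2 → ℤ, ∀ i, b.repr x i = k i := fun x hx =>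
    ⟨fun i => b0.repr ⟨x, hx⟩ i, fun i =>
      Module.Basis.ofZLatticeBasis_repr_apply ℝ X.lattice _ ⟨x, hx⟩ i⟩
  refine ⟨⟨H, fun x y => ?_, fun x hx y hy => ?_⟩, fun x hx => ?_, fun x hx => ?_⟩
  · rw [hH, hH]
    simp only [map_mul, Complex.conj_ofReal, Complex.conj_conj]
    ring
  · obtain ⟨k, hk⟩ := hint x hx
    obtain ⟨l, hl⟩ := hint y hy
    refine ⟨σ * (k 0 * l 1 - k 1 * l 0), ?_⟩
    rw [hexp x, hexp y, hHb, hk, hk, hl, hl, hσ]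
    push_cast
    ring
  · change 0 < (H x x).re
    rw [hH, mul_assoc, Complex.mul_conj, ← Complex.ofReal_mul, Complex.ofReal_re]
    have : 0 < Complex.normSq (c x) := Complex.normSq_pos.2 fun h => hx (c.map_eq_zero_iff.1 h)
    have := abs_pos.2 hD
    positivity
  · obtain ⟨k, hk⟩ := hx _ (hbmem 0)
    obtain ⟨l, hl⟩ := hx _ (hbmem 1)
    change (H x (b 0)).im = k at hk
    change (H x (b 1)).im = l at hl
    have hk' := hHb (b.repr x 0) (b.repr x 1) 1 0
    have hl' := hHb (b.repr x 0) (b.repr x 1) 0 1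
    rw [← hexp x, hσ, one_smul, zero_smul, add_zero, hk] at hk'
    rw [← hexp x, hσ, one_smul, zero_smul, zero_add, hl] at hl'
    have hσ3 : (σ : ℝ) * σ = 1 := by exact_mod_cast hσ2
    have e1 : b.repr x 1 = ((-(σ * k) : ℤ) : ℝ) := by
      push_cast
      linear_combination (σ : ℝ) * hk' - b.repr x 1 * hσ3
    have e0 : b.repr x 0 = ((σ * l : ℤ) : ℝ) := by
      push_cast
      linear_combination (-(σ : ℝ)) * hl' - b.repr x 0 * hσ3
    rw [hexp x, e0, e1, Int.cast_smul_eq_zsmul, Int.cast_smul_eq_zsmul]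
    exact add_mem (X.lattice.smul_mem _ (hbmem 0)) (X.lattice.smul_mem _ (hbmem 1))

/-- An elliptic curve is isomorphic to its dual. -/
theorem IsEllipticCurve.exists_linearEquiv_dual {X : ComplexTorus.{u}} (hX : X.IsEllipticCurve) :
    ∃ F : X.V ≃ₗ[ℂ] (X.V →L⋆[ℂ] ℂ), ∀ x, F x ∈ X.dualLattice ↔ x ∈ X.lattice := by
  obtain ⟨L, hpos, hL⟩ := hX.exists_principal
  have hinj : Function.Injective L.form.toLinearMap := by
    refine (injective_iff_map_eq_zero _).2 fun x hx => ?_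
    by_contra h
    have h1 := hpos x h
    have h2 : L.form x = 0 := hx
    rw [h2] at h1
    simp at h1
  -- Taking imaginary parts identifies antilinear functionals with real ones, so the real dimensions
  -- agree, hence the complex ones.
  have hdim : Module.finrank ℂ X.V = Module.finrank ℂ (X.V →L⋆[ℂ] ℂ) := by
    have h1 := finrank_real_of_complex X.V
    have h2 := finrank_real_of_complex (X.V →L⋆[ℂ] ℂ)
    let α : (X.V →L⋆[ℂ] ℂ) →ₗ[ℝ] (X.V →ₗ[ℝ] ℝ) :=
      { toFun := fun l =>
          { toFun := fun x => (l x).im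
            map_add' := fun x y => by simp
            map_smul' := fun c x => by
              have := l.map_smulₛₗ (c : ℂ) x
              rw [← Complex.coe_smul c x, this]
              simp }
        map_add' := fun l l' => by ext x; simp
        map_smul' := fun c l => by ext x; simp }
    have hα : Function.Bijective α := by
      refine ⟨fun l l' h => ?_, fun β => ?_⟩
      · have him : ∀ x, (l x).im = (l' x).im := fun x => LinearMap.congr_fun h x
        exact ContinuousLinearMap.ext fun x => Complex.ext
          (by rw [antilinear_re, antilinear_re, him]) (him x)
      · obtain ⟨l, hl⟩ := X.exists_antilinear β
        exact ⟨l, LinearMap.ext hl⟩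
    have h3 := (LinearEquiv.ofBijective α hα).finrank_eq
    rw [Module.finrank_linearMap, Module.finrank_self, mul_one] at h3
    lia
  refine ⟨LinearMap.linearEquivOfInjective L.form.toLinearMap hinj hdim, fun x => ?_⟩
  -- Being principal is exactly the statement that `φ_L` reflects the lattices.
  exact ⟨fun h => hL x h, fun h => L.integral x h⟩

/-! ### The real alternating form and the vector dual to a torsion point -/

namespace NeronSeveri

/-- The alternating form `Im H` of a class with Hermitian form `H`. -/
def imForm {X : ComplexTorus.{u}} (L : NeronSeveri X) : X.V →ₗ[ℝ] X.V →ₗ[ℝ] ℝ :=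
  LinearMap.mk₂ ℝ (fun x y => (L.form x y).im)
    (fun x x' y => by simp)
    (fun c x y => by
      rw [← Complex.coe_smul c x, map_smul]
      simp)
    (fun x y y' => by simp)
    (fun c x y => by
      rw [← Complex.coe_smul c y, (L.form x).map_smulₛₗ]
      simp)

theorem imForm_apply {X : ComplexTorus.{u}} (L : NeronSeveri X) (x y : X.V) :
    L.imForm x y = (L.form x y).im := rfl

theorem imForm_swap {X : ComplexTorus.{u}} (L : NeronSeveri X) (x y : X.V) :
    L.imForm y x = -L.imForm x y :=
  L.im_form_swap x y

theorem imForm_self {X : ComplexTorus.{u}} (L : NeronSeveri X) (x : X.V) : L.imForm x x = 0 :=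
  L.im_form_self x

theorem imForm_cramer {X : ComplexTorus.{u}} (hX : X.IsEllipticCurve) (L : NeronSeveri X)
    (x y z : X.V) : L.imForm x y • z = L.imForm z y • x + L.imForm x z • y := by
  have := L.cramer hX x y z
  rwa [Complex.coe_smul, Complex.coe_smul, Complex.coe_smul] at this

/-- For a principal class on `X` and `p ∈ X.V` representing a point of order `d`, some lattice
vector pairs with the lattice vector `d p` to `1` modulo `d`. -/
theorem IsPrincipal.exists_dual_vector {X : ComplexTorus.{u}} {L : NeronSeveri X}
    (hL : L.IsPrincipal) {p : X.V} {d : ℕ} (hd : d ≠ 0)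
    (hp : ∀ k : ℤ, k • p ∈ X.lattice ↔ (d : ℤ) ∣ k) :
    ∃ e ∈ X.lattice, ∃ t : ℤ, d * L.imForm p e = 1 + d * t := by
  -- The values `d Im H(p, e)` for `e` in the lattice, together with the multiples of `d`, form an
  -- ideal; the claim is that it contains `1`.
  let I : Ideal ℤ :=
    { carrier := {n | ∃ e ∈ X.lattice, ∃ t : ℤ, d * L.imForm p e = n + d * t}
      zero_mem' := ⟨0, X.lattice.zero_mem, 0, by simp⟩
      add_mem' := by
        rintro a b ⟨e, he, t, h⟩ ⟨e', he', t', h'⟩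
        refine ⟨e + e', add_mem he he', t + t', ?_⟩
        push_cast
        rw [map_add]
        linear_combination h + h'
      smul_mem' := by
        rintro c a ⟨e, he, t, h⟩
        refine ⟨c • e, X.lattice.smul_mem c he, c * t, ?_⟩
        rw [map_zsmul, zsmul_eq_mul, smul_eq_mul]
        push_cast
        linear_combination (c : ℝ) * h }
  obtain ⟨g, hg⟩ := (IsPrincipalIdealRing.principal I).principal
  have hmem : ∀ n, n ∈ I ↔ g ∣ n := fun n => by rw [hg]; exact Ideal.mem_span_singleton
  obtain ⟨c, hc⟩ : g ∣ (d : ℤ) := (hmem d).1 ⟨0, X.lattice.zero_mem, -1, by simp⟩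
  have hd' : (d : ℤ) ≠ 0 := by exact_mod_cast hd
  have hg0 : g ≠ 0 := by rintro rfl; simp at hc; exact hd hc
  -- With `d = g c`, every value `n = d Im H(p, y)` is divisible by `g`, so `Im H(c p, y) = n / g`
  -- is an integer. Principality puts `c p` in the lattice; then `d ∣ c` by the order of `p`, and
  -- `g` is a unit.
  have hcp : c • p ∈ X.lattice := by
    refine hL _ fun y hy => ?_
    obtain ⟨n, hn⟩ := L.integral _ ((hp d).2 dvd_rfl) y hy
    rw [← imForm_apply, map_zsmul, LinearMap.smul_apply, zsmul_eq_mul] at hn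
    obtain ⟨s, hs⟩ := (hmem n).1 ⟨y, hy, 0, by simpa using hn⟩
    refine ⟨s, ?_⟩
    rw [← imForm_apply, map_zsmul, LinearMap.smul_apply, zsmul_eq_mul]
    have hg' : (g : ℝ) ≠ 0 := by exact_mod_cast hg0
    refine mul_left_cancel₀ hg' ?_
    rw [hc, hs] at hn
    push_cast at hn
    linear_combination hn
  obtain ⟨c', hc'⟩ := (hp c).1 hcp
  have h1 : g * c' = 1 := by
    refine mul_left_cancel₀ hd' ?_
    linear_combination (-g) * hc' - hc
  obtain ⟨e, he, t, h⟩ := (hmem 1).2 ⟨c', h1.symm⟩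
  exact ⟨e, he, t, by simpa using h⟩

end NeronSeveri

/-! ### The lattice of `(E × B) / ⟨(P, Q)⟩` and the class on it -/

section Glue

variable {E : ComplexTorus.{u}} {B : ComplexTorus.{v}} {P : E.Pt} {Q : B.Pt}

/-- The torus `(E × B) / ⟨(P, Q)⟩`. -/
abbrev glue (hG : Finite (AddSubgroup.zmultiples (pair P Q))) : ComplexTorus.{max u v} :=
  (E.prod B).quotient (AddSubgroup.zmultiples (pair P Q)) hG

variable (hG : Finite (AddSubgroup.zmultiples (pair P Q))) {p : E.V} {q : B.V}
  (hP : E.proj p = P) (hQ : B.proj q = Q)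

include hP hQ in
theorem mem_glue_lattice (x : E.V) (y : B.V) :
    ((x, y) : E.V × B.V) ∈ (glue hG).lattice ↔
      ∃ k : ℤ, x - k • p ∈ E.lattice ∧ y - k • q ∈ B.lattice := by
  subst hP hQ
  have hpair : pair (E.proj p) (B.proj q) = (E.prod B).proj ((p, q) : E.V × B.V) := by
    have h : ((p, 0) + (0, q) : E.V × B.V) = (p, q) := Prod.ext (add_zero p) (zero_add q)
    exact ((E.prod B).proj.map_add _ _).symm.trans (congrArg (E.prod B).proj h)
  change (E.prod B).proj ((x, y) : E.V × B.V) ∈ AddSubgroup.zmultiples _ ↔ _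
  rw [AddSubgroup.mem_zmultiples_iff]
  refine exists_congr fun k => ?_
  rw [hpair, eq_comm]
  have h := (E.prod B).proj_eq_proj (x := ((x, y) : E.V × B.V)) (y := k • ((p, q) : E.V × B.V))
  exact Iff.trans (Eq.congr_right ((E.prod B).proj.map_smul k _).symm) h

variable {d : ℕ} (hpd : ∀ k : ℤ, k • p ∈ E.lattice ↔ (d : ℤ) ∣ k)
  (hqd : ∀ k : ℤ, k • q ∈ B.lattice ↔ (d : ℤ) ∣ k)

include hP hQ hqd hpd in
-- This is where the orders of `P` and `Q` must agree: if `k q` is a lattice vector, then so is `k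
-- p`. Hence `E` embeds in the quotient.
theorem inl_mem_glue_lattice (x : E.V) :
    ((x, 0) : E.V × B.V) ∈ (glue hG).lattice ↔ x ∈ E.lattice := by
  rw [mem_glue_lattice hG hP hQ]
  refine ⟨?_, fun h => ⟨0, by simpa using h, by simp⟩⟩
  rintro ⟨k, h1, h2⟩
  rw [zero_sub, neg_mem_iff, hqd, ← hpd] at h2
  simpa using add_mem h1 h2

include hP hQ hqd hpd in
theorem inr_mem_glue_lattice (y : B.V) :
    ((0, y) : E.V × B.V) ∈ (glue hG).lattice ↔ y ∈ B.lattice := by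
  rw [mem_glue_lattice hG hP hQ]
  refine ⟨?_, fun h => ⟨0, by simp, by simpa using h⟩⟩
  rintro ⟨k, h1, h2⟩
  rw [zero_sub, neg_mem_iff, hpd, ← hqd] at h1
  simpa using add_mem h2 h1

include hP hQ hqd hpd in
-- The quotient map has kernel of exponent dividing `d`, so `d` carries the new lattice back into
-- the old one.
theorem smul_mem_of_mem_glue_lattice {x : E.V} {y : B.V}
    (h : ((x, y) : E.V × B.V) ∈ (glue hG).lattice) :
    d • x ∈ E.lattice ∧ d • y ∈ B.lattice := by
  obtain ⟨k, h1, h2⟩ := (mem_glue_lattice hG hP hQ x y).1 h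
  have e1 : d • x = d • (x - k • p) + (d * k : ℤ) • p := by
    rw [mul_smul, natCast_zsmul, ← smul_add, sub_add_cancel]
  have e2 : d • y = d • (y - k • q) + (d * k : ℤ) • q := by
    rw [mul_smul, natCast_zsmul, ← smul_add, sub_add_cancel]
  rw [e1, e2]
  exact ⟨add_mem (nsmul_mem h1 d) ((hpd _).2 (Dvd.intro _ rfl)),
    add_mem (nsmul_mem h2 d) ((hqd _).2 (Dvd.intro _ rfl))⟩

/-- The Hermitian form `d H_E ⊞ H_B`. -/
def glueForm (d : ℕ) (LE : NeronSeveri E) (LB : NeronSeveri B) :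
    (E.V × B.V) →L[ℂ] (E.V × B.V →L⋆[ℂ] ℂ) :=
  (d : ℂ) • (ContinuousLinearMap.precomp ℂ (ContinuousLinearMap.fst ℂ E.V B.V)).comp
      (LE.form.comp (ContinuousLinearMap.fst ℂ E.V B.V)) +
    (ContinuousLinearMap.precomp ℂ (ContinuousLinearMap.snd ℂ E.V B.V)).comp
      (LB.form.comp (ContinuousLinearMap.snd ℂ E.V B.V))

theorem glueForm_apply (d : ℕ) (LE : NeronSeveri E) (LB : NeronSeveri B) (z z' : E.V × B.V) :
    glueForm d LE LB z z' = d * LE.form z.1 z'.1 + LB.form z.2 z'.2 := rfl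

theorem im_glueForm (d : ℕ) (LE : NeronSeveri E) (LB : NeronSeveri B) (z z' : E.V × B.V) :
    (glueForm d LE LB z z').im = d * LE.imForm z.1 z'.1 + LB.imForm z.2 z'.2 := by
  rw [glueForm_apply, Complex.add_im, ← Complex.ofReal_natCast, Complex.im_ofReal_mul]
  rfl

theorem glueForm_hermitian (d : ℕ) (LE : NeronSeveri E) (LB : NeronSeveri B) (z z' : E.V × B.V) :
    glueForm d LE LB z' z = (starRingEnd ℂ) (glueForm d LE LB z z') := by
  rw [glueForm_apply, glueForm_apply, LE.hermitian z.1, LB.hermitian z.2]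
  simp

/-- The class `d H_E ⊞ H_B` on `(E × B) / ⟨(P, Q)⟩`, for `P` of order `d` and `Q ∈ ker φ_B`. -/
def glueClass (LE : NeronSeveri E) (LB : NeronSeveri B)
    (hqL : ∀ y ∈ B.lattice, ∃ k : ℤ, (LB.form q y).im = k) : NeronSeveri (glue hG) where
  form := glueForm d LE LB
  hermitian := glueForm_hermitian d LE LB
  integral := by
    rintro ⟨x, y⟩ hz ⟨x', y'⟩ hz'
    obtain ⟨k, h1, h2⟩ := (mem_glue_lattice hG hP hQ x y).1 hz
    obtain ⟨k', h1', h2'⟩ := (mem_glue_lattice hG hP hQ x' y').1 hz'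
    obtain ⟨a, ha⟩ := LE.integral _ h1 _ h1'
    obtain ⟨b, hb⟩ := LB.integral _ h2 _ h2'
    -- The cross terms are integral: on `E` the factor `d` is absorbed into `d p`, a lattice vector;
    -- on `B` the vector `q` pairs integrally with the lattice. The terms `(p, p)` and `(q, q)`
    -- vanish.
    have hdp := (hpd d).2 dvd_rfl
    obtain ⟨a1, ha1⟩ := LE.integral _ hdp _ h1
    obtain ⟨a2, ha2⟩ := LE.integral _ hdp _ h1'
    obtain ⟨b1, hb1⟩ := hqL _ h2
    obtain ⟨b2, hb2⟩ := hqL _ h2'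
    refine ⟨d * a - k' * a1 + k * a2 + b - k' * b1 + k * b2, ?_⟩
    refine (im_glueForm d LE LB _ _).trans ?_
    rw [← NeronSeveri.imForm_apply] at ha hb ha1 ha2 hb1 hb2
    simp only [map_sub, LinearMap.sub_apply, map_zsmul, LinearMap.smul_apply, zsmul_eq_mul,
      NeronSeveri.imForm_self, LE.imForm_swap p x, LB.imForm_swap q y, Int.cast_natCast]
      at ha hb ha1 ha2 hb1 hb2
    push_cast
    rw [← ha, ← hb, ← ha1, ← ha2, ← hb1, ← hb2]
    ring

end Glue

/-! ### Positivity and kernel of the glued class -/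

section Glue

variable {E : ComplexTorus.{u}} {B : ComplexTorus.{v}} {P : E.Pt} {Q : B.Pt}
  (hG : Finite (AddSubgroup.zmultiples (pair P Q))) {p : E.V} {q : B.V}
  (hP : E.proj p = P) (hQ : B.proj q = Q) {d : ℕ}
  (hpd : ∀ k : ℤ, k • p ∈ E.lattice ↔ (d : ℤ) ∣ k)
  (hqd : ∀ k : ℤ, k • q ∈ B.lattice ↔ (d : ℤ) ∣ k)
  {LE : NeronSeveri E} {LB : NeronSeveri B}
  (hqL : ∀ y ∈ B.lattice, ∃ k : ℤ, (LB.form q y).im = k)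

theorem glueClass_isPolarisation (hd : d ≠ 0) (hE : LE.IsPolarisation) (hB : LB.IsPolarisation) :
    (glueClass hG hP hQ hpd LE LB hqL).IsPolarisation := by
  rintro ⟨x, y⟩ hz
  change 0 < (glueForm d LE LB (x, y) (x, y)).re
  rw [glueForm_apply, Complex.add_re, ← Complex.ofReal_natCast, Complex.re_ofReal_mul]
  have hd' : (0 : ℝ) < d := by exact_mod_cast Nat.pos_of_ne_zero hd
  have hEn : ∀ x, 0 ≤ (LE.form x x).re := fun x => by
    rcases eq_or_ne x 0 with rfl | h
    · simp
    · exact (hE x h).le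
  have hBn : ∀ x, 0 ≤ (LB.form x x).re := fun x => by
    rcases eq_or_ne x 0 with rfl | h
    · simp
    · exact (hB x h).le
  rcases eq_or_ne x 0 with rfl | hx
  · have hy : y ≠ 0 := by rintro rfl; exact hz rfl
    exact add_pos_of_nonneg_of_pos (mul_nonneg hd'.le (hEn _)) (hB y hy)
  · exact add_pos_of_pos_of_nonneg (mul_pos hd' (hE x hx)) (hBn _)

theorem glueClass_phi_eq_zero (x : E.V) (y : B.V) :
    (glueClass hG hP hQ hpd LE LB hqL).phi ((glue hG).proj ((x, y) : E.V × B.V)) = 0 ↔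
      ∀ x' y', ((x', y') : E.V × B.V) ∈ (glue hG).lattice →
        ∃ k : ℤ, d * LE.imForm x x' + LB.imForm y y' = k := by
  refine (NeronSeveri.phi_proj_eq_zero _ _).trans ⟨fun h x' y' hz => ?_, fun h z hz => ?_⟩
  · obtain ⟨k, hk⟩ := h _ hz
    exact ⟨k, (im_glueForm d LE LB (x, y) (x', y')).symm.trans hk⟩
  · obtain ⟨k, hk⟩ := h z.1 z.2 hz
    exact ⟨k, (im_glueForm d LE LB (x, y) z).trans hk⟩

/-- The additive map `y ↦ (-Im H_B(q, y) e, y)`. -/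
def twistLinear (LB : NeronSeveri B) (q : B.V) (e : E.V) : B.V →ₗ[ℤ] E.V × B.V :=
  (((-LB.imForm q).smulRight e).prod LinearMap.id).restrictScalars ℤ

theorem twistLinear_apply (LB : NeronSeveri B) (q : B.V) (e : E.V) (y : B.V) :
    twistLinear LB q e y = (-LB.imForm q y • e, y) := rfl

include hP hQ hqL in
theorem twistLinear_mem {e : E.V} (he : e ∈ E.lattice) {y : B.V} (hy : y ∈ B.lattice) :
    twistLinear LB q e y ∈ (glue hG).lattice := by
  rw [twistLinear_apply]
  refine (mem_glue_lattice hG hP hQ _ _).2 ⟨0, ?_, by simpa using hy⟩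
  obtain ⟨k, hk⟩ := hqL y hy
  rw [NeronSeveri.imForm_apply, hk, ← Int.cast_neg, Int.cast_smul_eq_zsmul, zero_smul, sub_zero]
  exact E.lattice.smul_mem _ he

/-- The homomorphism of real tori `B → (E × B) / ⟨(P, Q)⟩` induced by `twistLinear`. -/
def twist {e : E.V} (he : e ∈ E.lattice) : B.Pt →+ (glue hG).Pt :=
  (B.lattice.mapQ (glue hG).lattice (twistLinear LB q e)
    fun _ hy => twistLinear_mem hG hP hQ hqL he hy).toAddMonoidHom

theorem twist_proj {e : E.V} (he : e ∈ E.lattice) (y : B.V) :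
    twist hG hP hQ hqL he (B.proj y) = (glue hG).proj (twistLinear LB q e y) := rfl

section Kernel

variable {e : E.V} (he : e ∈ E.lattice) {t : ℤ} (het : d * LE.imForm p e = 1 + d * t)

include hqd het in
-- Put `s = Im H_B(q, y)`. Against `(p, q)` the corrected point pairs to `d s Im H_E(p, e) - s = s d
-- t`, and `d s` is an integer because `d q` is a lattice vector and `y` represents a point of `ker
-- φ_B`.
theorem twist_mem_ker {b : B.Pt} (hb : LB.phi b = 0) :
    (glueClass hG hP hQ hpd LE LB hqL).phi (twist hG hP hQ hqL he b) = 0 := by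
  obtain ⟨y, rfl⟩ := B.proj_surjective b
  rw [NeronSeveri.phi_proj_eq_zero] at hb
  rw [twist_proj]
  refine (glueClass_phi_eq_zero hG hP hQ hpd hqL _ _).2 fun x' y' hz => ?_
  obtain ⟨k, h1, h2⟩ := (mem_glue_lattice hG hP hQ x' y').1 hz
  obtain ⟨c, hc⟩ := hb _ ((hqd d).2 dvd_rfl)
  obtain ⟨a, ha⟩ := LE.integral _ he _ h1
  obtain ⟨b, hb⟩ := hb _ h2
  rw [← NeronSeveri.imForm_apply] at ha hb hc
  simp only [map_sub, map_zsmul, zsmul_eq_mul, LE.imForm_swap p e, LB.imForm_swap q y,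
    Int.cast_natCast] at ha hb hc
  refine ⟨c * a + b - k * t * c, ?_⟩
  change d * LE.imForm (-LB.imForm q y • e) x' + LB.imForm y y' = _
  simp only [map_smul, LinearMap.smul_apply, smul_eq_mul]
  push_cast
  rw [← ha, ← hb, ← hc]
  linear_combination (k * LB.imForm q y) * het

include hqd hpd in
-- If the image lies in the lattice with coefficient `k` of `(p, q)`, then `Im H_B(q, y)` is an
-- integer, as `y - k q` is a lattice vector. Thus `k p ∈ Λ_E`, so `d ∣ k` and `y ∈ Λ_B`.
theorem eq_zero_of_twist_eq_zero {b : B.Pt} (h0 : twist hG hP hQ hqL he b = 0) :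
    b = 0 := by
  obtain ⟨y, rfl⟩ := B.proj_surjective b
  rw [twist_proj] at h0
  obtain ⟨k, h1, h2⟩ := (mem_glue_lattice hG hP hQ (-LB.imForm q y • e) y).1
    (((glue hG).proj_eq_zero _).1 h0)
  obtain ⟨s, hs⟩ := hqL _ h2
  rw [← NeronSeveri.imForm_apply, map_sub, map_zsmul, NeronSeveri.imForm_self, smul_zero,
    sub_zero] at hs
  rw [hs, ← Int.cast_neg, Int.cast_smul_eq_zsmul] at h1
  have hk : k • p ∈ E.lattice := by
    have := sub_mem (E.lattice.smul_mem (-s) he) h1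
    simpa using this
  rw [hpd, ← hqd] at hk
  rw [proj_eq_zero]
  simpa using add_mem h2 hk

include hqd het in
-- In dimension one, `x` is determined by its pairings with `p` and `e`. Cramer's identity expresses
-- it through them, and modulo the lattice this is the correction term up to a multiple of `p`,
-- which is removed by subtracting the same multiple of `(p, q)`.
theorem twist_surjOn_ker (hE : E.IsEllipticCurve) (hLE : LE.IsPrincipal)
    {a : (glue hG).Pt} (ha : (glueClass hG hP hQ hpd LE LB hqL).phi a = 0) :
    ∃ b, LB.phi b = 0 ∧ twist hG hP hQ hqL he b = a := by
  obtain ⟨⟨x, y⟩, rfl⟩ := (glue hG).proj_surjective a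
  have ha' := (glueClass_phi_eq_zero hG hP hQ hpd hqL x y).1 ha
  -- Pairing with `Λ_E × 0` alone shows that `d x` is integral against `Λ_E`.
  have hdx : (d : ℝ) • x ∈ E.lattice := hLE _ fun z hz => by
    obtain ⟨k, hk⟩ := ha' z 0 ((inl_mem_glue_lattice hG hP hQ hpd hqd z).2 hz)
    refine ⟨k, ?_⟩
    rw [← NeronSeveri.imForm_apply, map_smul, LinearMap.smul_apply, smul_eq_mul]
    simpa using hk
  obtain ⟨N, hN⟩ := ha' p q ((mem_glue_lattice hG hP hQ p q).2 ⟨1, by simp, by simp⟩)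
  obtain ⟨c, hc⟩ := LE.integral _ hdx _ he
  rw [← NeronSeveri.imForm_apply, map_smul, LinearMap.smul_apply, smul_eq_mul] at hc
  rw [LE.imForm_swap p x, LB.imForm_swap q y] at hN
  -- Cramer's identity times `d` reads `(1 + d t) x = c p + d Im H_E(p, x) e`, and the pairing `N`
  -- with `(p, q)` evaluates the last coefficient.
  have hx : x = c • p - N • e - LB.imForm q y • e - t • ((d : ℝ) • x) := by
    have hcr := LE.imForm_cramer hE p e x
    have h1 : (d : ℝ) • (LE.imForm p e • x) = (d : ℝ) • (LE.imForm x e • p + LE.imForm p x • e) := by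
      rw [hcr]
    rw [smul_add, smul_smul, smul_smul, smul_smul, hc, het,
      show (d : ℝ) * LE.imForm p x = -N - LB.imForm q y by linear_combination -hN] at h1
    rw [← Int.cast_smul_eq_zsmul ℝ c, ← Int.cast_smul_eq_zsmul ℝ N, ← Int.cast_smul_eq_zsmul ℝ t]
    calc x = (1 + d * t : ℝ) • x - (t : ℝ) • ((d : ℝ) • x) := by module
      _ = _ := by rw [h1]; module
  -- Subtracting `c q` leaves the correction term unchanged, since `Im H_B(q, q) = 0`.
  refine ⟨B.proj (y - c • q), ?_, ?_⟩
  · rw [NeronSeveri.phi_proj_eq_zero]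
    intro z hz
    obtain ⟨k, hk⟩ := ha' 0 z ((inr_mem_glue_lattice hG hP hQ hpd hqd z).2 hz)
    obtain ⟨l, hl⟩ := hqL z hz
    refine ⟨k - c * l, ?_⟩
    rw [← NeronSeveri.imForm_apply] at hl ⊢
    rw [map_sub, LinearMap.sub_apply, map_zsmul, LinearMap.smul_apply, zsmul_eq_mul, hl]
    rw [map_zero, mul_zero, zero_add] at hk
    rw [hk]
    push_cast
    rfl
  · rw [twist_proj, eq_comm]
    refine ((glue hG).proj_eq_proj).2 ((mem_glue_lattice hG hP hQ
      (x - -LB.imForm q (y - c • q) • e) (y - (y - c • q))).2 ⟨c, ?_, by simp⟩)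
    rw [map_sub, map_zsmul, NeronSeveri.imForm_self, smul_zero, sub_zero]
    have : x - -LB.imForm q y • e - c • p = -(N • e) - t • ((d : ℝ) • x) := by
      conv_lhs => rw [hx]
      rw [neg_smul]
      abel
    rw [this]
    exact sub_mem (neg_mem (E.lattice.smul_mem N he)) (E.lattice.smul_mem t hdx)

include hqd in
/-- `ker φ_A` and `ker φ_B` are isomorphic for `A = (E × B) / ⟨(P, Q)⟩`. -/
theorem nonempty_kernel_equiv (hE : E.IsEllipticCurve) (hLE : LE.IsPrincipal) (hd : d ≠ 0) :
    Nonempty ((glueClass hG hP hQ hpd LE LB hqL).phi.toAddHom.ker ≃+ LB.phi.toAddHom.ker) := by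
  obtain ⟨e, he, t, het⟩ := hLE.exists_dual_vector hd hpd
  let θ : LB.phi.toAddHom.ker →+ (glueClass hG hP hQ hpd LE LB hqL).phi.toAddHom.ker :=
    ((twist hG hP hQ hqL he).comp (AddSubgroup.subtype _)).codRestrict _
      fun b => twist_mem_ker hG hP hQ hpd hqd hqL he het b.2
  refine ⟨(AddEquiv.ofBijective θ ⟨(injective_iff_map_eq_zero θ).2 fun b hb => ?_, fun a => ?_⟩).symm⟩
  · exact Subtype.ext (eq_zero_of_twist_eq_zero hG hP hQ hpd hqd hqL he (congrArg Subtype.val hb))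
  · obtain ⟨b, hb, h⟩ := twist_surjOn_ker hG hP hQ hpd hqd hqL he het hE hLE a.2
    exact ⟨⟨b, hb⟩, Subtype.ext h⟩

end Kernel

/-! ### The type and the complementary subvariety -/

theorem nonempty_consOne_equiv {m : ℕ} (d : Fin m → ℕ) :
    Nonempty ((∀ i, ZMod (d i)) ≃+
      ∀ i, ZMod ((Fin.cons 1 d : Fin (m + 1) → ℕ) i)) := by
  let ρ : (∀ i, ZMod ((Fin.cons 1 d : Fin (m + 1) → ℕ) i)) →+ ∀ i, ZMod (d i) :=
    { toFun := fun g i => g i.succ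
      map_zero' := rfl
      map_add' := fun _ _ => rfl }
  refine ⟨(AddEquiv.ofBijective ρ ⟨fun g g' h => funext fun i => ?_, fun g => ?_⟩).symm⟩
  · refine Fin.cases ?_ (fun j => congrFun h j) i
    exact @Subsingleton.elim (ZMod 1) inferInstance _ _
  · exact ⟨Fin.cons (α := fun i => ZMod ((Fin.cons 1 d : Fin (m + 1) → ℕ) i)) (0 : ZMod 1) g, rfl⟩

include hqd in
theorem glueClass_hasType (hE : E.IsEllipticCurve) (hLE : LE.IsPrincipal) (hd : d ≠ 0)
    {m : ℕ} {δ : Fin m → ℕ} (hB : LB.HasType δ) :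
    (glueClass hG hP hQ hpd LE LB hqL).HasType (Fin.cons 1 δ : Fin (m + 1) → ℕ) := by
  obtain ⟨hdim, hpos, hdvd, ⟨κ⟩⟩ := hB
  refine ⟨?_, ?_, ?_, ?_⟩
  · have h1 : Module.finrank ℂ E.V = 1 := hE
    have h2 : Module.finrank ℂ B.V = m := hdim
    have h3 : Module.finrank ℂ (E.V × B.V) = m + 1 := by
      rw [Module.finrank_prod, h1, h2, add_comm]
    exact h3
  · exact fun i => Fin.cases (by simp) (fun j => by simpa using hpos j) i
  · intro i j
    refine Fin.cases (by simp) (fun i => ?_) i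
    refine Fin.cases (by simp) (fun j hij => ?_) j
    simpa using hdvd i j (Fin.succ_le_succ_iff.1 hij)
  · obtain ⟨σ⟩ := nonempty_kernel_equiv hG hP hQ hpd hqd hqL hE hLE hd
    obtain ⟨ρ⟩ := nonempty_consOne_equiv δ
    exact ⟨(σ.trans κ).trans (AddEquiv.prodCongr ρ ρ)⟩

include hqd in
-- For an orthogonal sum the symmetric idempotent of `E` is the first projection, and `m = d` is a
-- multiple that makes it a homomorphism from the quotient to `E`. Then `m (1 - ε_E)` sends `(x, y)`
-- to `(0, d y)`.
theorem glueClass_isComplementary (hd : d ≠ 0) :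
    (glueClass hG hP hQ hpd LE LB hqL).IsComplementary
      (((E.prod B).quotientMap _ hG).comp (inl E B))
      (((E.prod B).quotientMap _ hG).comp (inr E B)) := by
  set ι := ((E.prod B).quotientMap _ hG).comp (inl E B) with hι
  set κ := ((E.prod B).quotientMap _ hG).comp (inr E B) with hκ
  have hιr : ι.rep = ContinuousLinearMap.inl ℂ E.V B.V := Hom.rep_eq _ _ fun _ => rfl
  have hκr : κ.rep = ContinuousLinearMap.inr ℂ E.V B.V := Hom.rep_eq _ _ fun _ => rfl
  let f : Hom (glue hG) E := Hom.ofLinear (X := glue hG)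
    ((d : ℂ) • ContinuousLinearMap.fst ℂ E.V B.V) fun z hz => by
      have := (smul_mem_of_mem_glue_lattice hG hP hQ hpd hqd (x := z.1) (y := z.2) hz).1
      rw [← Nat.cast_smul_eq_nsmul ℂ] at this
      exact this
  have hκp : ∀ y, κ (B.proj y) = (glue hG).proj ((0, y) : E.V × B.V) := fun _ => rfl
  have hsub : ∀ x y, d • (glue hG).proj ((x, y) : E.V × B.V) -
      ι (f ((glue hG).proj ((x, y) : E.V × B.V))) = κ (B.proj (d • y)) := by
    intro x y
    have h : (d • (x, y) - ((d : ℂ) • x, 0) : E.V × B.V) = (0, d • y) := by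
      rw [Nat.cast_smul_eq_nsmul]
      ext <;> simp
    rw [hκp, ← h]
    exact (congrArg (· - _) (map_nsmul (glue hG).proj d _).symm).trans
      ((glue hG).proj.map_sub _ _).symm
  refine ⟨Hom.injective_of_rep _ fun x hx => ?_, Hom.injective_of_rep _ fun y hy => ?_,
    d, f, Nat.pos_of_ne_zero hd, fun a => ?_, ?_⟩
  · rw [hιr] at hx
    exact (inl_mem_glue_lattice hG hP hQ hpd hqd x).1 hx
  · rw [hκr] at hy
    exact (inr_mem_glue_lattice hG hP hQ hpd hqd y).1 hy
  · obtain ⟨⟨x, y⟩, rfl⟩ := (glue hG).proj_surjective a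
    set L := glueClass hG hP hQ hpd LE LB hqL with hL
    have h : (L.pullback ι).form ((d : ℂ) • x) = d • (ContinuousLinearMap.precomp ℂ ι.rep)
        (L.form ((x, y) : E.V × B.V)) := by
      refine ContinuousLinearMap.ext fun z => ?_
      have hιx : ∀ z, ι.rep z = ((z, 0) : E.V × B.V) := fun z => by rw [hιr]; rfl
      have h1 : (L.pullback ι).form ((d : ℂ) • x) z = glueForm d LE LB ((d : ℂ) • x, 0) (z, 0) :=
        congrArg₂ (fun a b : E.V × B.V => glueForm d LE LB a b) (hιx _) (hιx _)
      have h2 : (d • (ContinuousLinearMap.precomp ℂ ι.rep) (L.form ((x, y) : E.V × B.V))) z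
          = d • glueForm d LE LB (x, y) (z, 0) :=
        congrArg (fun b : E.V × B.V => d • glueForm d LE LB (x, y) b) (hιx _)
      rw [h1, h2, glueForm_apply, glueForm_apply]
      simp
    exact (congrArg E.dual.proj h).trans (map_nsmul E.dual.proj d _)
  · ext a
    constructor
    · rintro ⟨b, rfl⟩
      obtain ⟨y, rfl⟩ := B.proj_surjective b
      -- The image is all of `B` because `B` is divisible.
      refine ⟨(glue hG).proj ((0, (d : ℂ)⁻¹ • y) : E.V × B.V), ?_⟩
      refine (hsub _ _).trans ?_
      rw [← Nat.cast_smul_eq_nsmul ℂ, smul_inv_smul₀ (by exact_mod_cast hd)]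
    · rintro ⟨b, rfl⟩
      obtain ⟨⟨x, y⟩, rfl⟩ := (glue hG).proj_surjective b
      exact ⟨_, (hsub x y).symm⟩

end Glue

/-! ### The quotient is not self-dual -/

/-- If `Hom(E, B) = 0` and `(E × B) / ⟨(P, Q)⟩` is self-dual, then `E / ⟨P⟩` is isomorphic to
`E`. -/
theorem isomorphic_quotient_of_isomorphic_dual {E : ComplexTorus.{u}} {B : ComplexTorus.{v}}
    {P : E.Pt} {Q : B.Pt} (hG : Finite (AddSubgroup.zmultiples (pair P Q)))
    (hGP : Finite (AddSubgroup.zmultiples P)) {p : E.V} {q : B.V}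
    (hP : E.proj p = P) (hQ : B.proj q = Q) {d : ℕ} (hd : d ≠ 0)
    (hpd : ∀ k : ℤ, k • p ∈ E.lattice ↔ (d : ℤ) ∣ k)
    (hqd : ∀ k : ℤ, k • q ∈ B.lattice ↔ (d : ℤ) ∣ k)
    (hE : E.IsEllipticCurve) (hEB : ∀ (f : Hom E B) (x : E.Pt), f x = 0)
    (h : Isomorphic (glue hG).dual (glue hG)) :
    Isomorphic (E.quotient (AddSubgroup.zmultiples P) hGP) E := by
  obtain ⟨F, hF⟩ := h.exists_linearEquiv
  obtain ⟨Φ, hΦ⟩ := hE.exists_linearEquiv_dual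
  have hE' : (E.quotient (AddSubgroup.zmultiples P) hGP).IsEllipticCurve := hE
  obtain ⟨Ψ, hΨ⟩ := hE'.exists_linearEquiv_dual
  -- Dual of the first projection `(E × B)/⟨(P, Q)⟩ → E/⟨P⟩`.
  let inc : (E.V →L⋆[ℂ] ℂ) →ₗ[ℂ] (E.V × B.V →L⋆[ℂ] ℂ) :=
    (ContinuousLinearMap.precomp ℂ (ContinuousLinearMap.fst ℂ E.V B.V)).toLinearMap
  have hinc : ∀ l z, inc l z = l z.1 := fun _ _ => rfl
  let F' : (E.V × B.V →L⋆[ℂ] ℂ) →ₗ[ℂ] E.V × B.V := F.toLinearMap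
  have hF' : ∀ l : E.V × B.V →L⋆[ℂ] ℂ, F' l ∈ (glue hG).lattice ↔
      ∀ x y, ((x, y) : E.V × B.V) ∈ (glue hG).lattice → ∃ k : ℤ, (l (x, y)).im = k :=
    fun l => (hF l).trans ⟨fun h x y hz => h _ hz, fun h z hz => h z.1 z.2 hz⟩
  have hF'inj : Function.Injective F' := F.injective
  let T : E.V →ₗ[ℂ] E.V × B.V := F' ∘ₗ inc ∘ₗ Φ.toLinearMap
  have hT : ∀ x, T x = F' (inc (Φ x)) := fun _ => rfl
  have hmemP : ∀ x : E.V, x ∈ (E.quotient (AddSubgroup.zmultiples P) hGP).lattice ↔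
      ∃ k : ℤ, x - k • p ∈ E.lattice := by
    intro x
    change E.proj x ∈ AddSubgroup.zmultiples P ↔ _
    rw [AddSubgroup.mem_zmultiples_iff, ← hP]
    refine exists_congr fun k => ?_
    rw [← map_zsmul, eq_comm, proj_eq_proj]
  -- The glued lattice projects onto the lattice of `E/⟨P⟩`, so a functional of the first variable
  -- is integral on the one exactly when it is integral on the other.
  have hTmem : ∀ x, T x ∈ (glue hG).lattice ↔
      Φ x ∈ (E.quotient (AddSubgroup.zmultiples P) hGP).dualLattice := by
    intro x
    rw [hT, hF']
    refine ⟨fun h z hz => ?_, fun h z y hz => ?_⟩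
    · obtain ⟨k, hk⟩ := (hmemP z).1 hz
      exact h z (k • q) ((mem_glue_lattice hG hP hQ _ _).2 ⟨k, hk, by simp⟩)
    · obtain ⟨k, hk, -⟩ := (mem_glue_lattice hG hP hQ _ _).1 hz
      exact h z ((hmemP z).2 ⟨k, hk⟩)
  -- One factor `d` makes a functional integral on `Λ_E` integral on the glued lattice; the other
  -- brings the second component of the image into `Λ_B`.
  have hTsnd : ∀ x, (T x).2 = 0 := by
    have h0 := eq_zero_of_hom_eq_zero hEB
      (LinearMap.toContinuousLinearMap (LinearMap.snd ℂ E.V B.V ∘ₗ T)) (d * d)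
      (mul_ne_zero hd hd) fun x hx => by
        have h1 : d • T x ∈ (glue hG).lattice := by
          have h2 : d • T x = F' (d • inc (Φ x)) := by rw [hT, map_nsmul]
          rw [h2, hF']
          intro z y hz
          obtain ⟨k, hk⟩ := (hΦ x).2 hx _
            (smul_mem_of_mem_glue_lattice hG hP hQ hpd hqd hz).1
          refine ⟨k, ?_⟩
          rw [← hk, map_nsmul]
          rfl
        have h3 := (smul_mem_of_mem_glue_lattice hG hP hQ hpd hqd
          (x := (d • T x).1) (y := (d • T x).2) h1).2
        rw [mul_smul]
        exact h3
    exact fun x => DFunLike.congr_fun h0 x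
  let g : E.V →ₗ[ℂ] E.V := LinearMap.fst ℂ E.V B.V ∘ₗ T
  have hTg : ∀ x, T x = (g x, 0) := fun x => Prod.ext rfl (hTsnd x)
  have hg : Function.Injective g := by
    intro x x' hx
    have h1 : T x = T x' := by rw [hTg, hTg, hx]
    have h2 := hF'inj h1
    refine Φ.injective (ContinuousLinearMap.ext fun z => ?_)
    exact DFunLike.congr_fun h2 ((z, 0) : E.V × B.V)
  -- `E/⟨P⟩` and `E` share their universal cover; only the lattices differ.
  let Ψ' : E.V ≃ₗ[ℂ] (E.V →L⋆[ℂ] ℂ) := Ψ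
  let g' : E.V ≃ₗ[ℂ] E.V := LinearEquiv.ofInjectiveEndo g hg
  have hg' : ∀ x, g' x = g x := fun _ => rfl
  refine isomorphic_of_linearEquiv (X := E.quotient (AddSubgroup.zmultiples P) hGP)
    ((Ψ'.trans Φ.symm).trans g') fun x => ?_
  change g (Φ.symm (Ψ' x)) ∈ E.lattice ↔ _
  -- `Φ` served only as a coordinate and cancels; what remains is the self-duality `Ψ` of `E/⟨P⟩`
  -- followed by the embedding of its dual onto `E`.
  rw [← inl_mem_glue_lattice hG hP hQ hpd hqd, ← hTg, hTmem, LinearEquiv.apply_symm_apply]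
  exact hΨ x

theorem smul_mem_lattice_iff {X : ComplexTorus.{u}} {x : X.V} {d : ℕ}
    (h : addOrderOf (X.proj x) = d) (k : ℤ) : k • x ∈ X.lattice ↔ (d : ℤ) ∣ k := by
  rw [← h, addOrderOf_dvd_iff_zsmul_eq_zero, ← map_zsmul, proj_eq_zero]

end ComplexTorus

end

open ComplexTorus in
theorem theorem3p2 {m : ℕ} (d : Fin (m + 1) → ℕ) (hd : 1 < d (Fin.last m))
    (E : ComplexTorus.{u}) (hE : E.IsEllipticCurve)
    (P : E.Pt) (hP : addOrderOf P = d (Fin.last m))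
    (hEP : ¬ Isomorphic (E.quotient (AddSubgroup.zmultiples P) (finite_zmultiples_of_addOrderOf hP hd)) E)
    (B : ComplexTorus.{v}) (LB : NeronSeveri B) (hLB : LB.IsPolarisation) (hBd : LB.HasType d)
    (hEB : ∀ (f : Hom E B) (x : E.Pt), f x = 0)
    (Q : B.Pt) (hQ : addOrderOf Q = d (Fin.last m)) (hQL : LB.phi Q = 0) :
    let G : AddSubgroup (E.prod B).Pt := AddSubgroup.zmultiples (pair P Q)
    let hG : Finite G := finite_zmultiples_pair hP hQ hd
    let A : ComplexTorus.{max u v} := (E.prod B).quotient G hG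
    let π : Hom (E.prod B) A := (E.prod B).quotientMap G hG
    (∃ LA : NeronSeveri A, LA.IsPolarisation ∧
        LA.HasType (Fin.cons 1 d : Fin (m + 2) → ℕ) ∧
        LA.IsComplementary (π.comp (inl E B)) (π.comp (inr E B))) ∧
      ¬ Isomorphic A.dual A := by
  intro G hG A π
  obtain ⟨p, hp⟩ := E.proj_surjective P
  obtain ⟨q, hq⟩ := B.proj_surjective Q
  have hd0 : d (Fin.last m) ≠ 0 := by lia
  have hpd := smul_mem_lattice_iff (x := p) (by rw [hp, hP])
  have hqd := smul_mem_lattice_iff (x := q) (by rw [hq, hQ])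
  have hqL := (LB.phi_proj_eq_zero q).1 (by rw [hq, hQL])
  obtain ⟨LE, hLE, hLEp⟩ := hE.exists_principal
  refine ⟨⟨glueClass hG hp hq hpd LE LB hqL, ?_, ?_, ?_⟩, fun h => hEP ?_⟩
  · exact glueClass_isPolarisation hG hp hq hpd hqL hd0 hLE hLB
  · exact glueClass_hasType hG hp hq hpd hqd hqL hE hLEp hd0 hBd
  · exact glueClass_isComplementary hG hp hq hpd hqd hqL hd0
  · exact isomorphic_quotient_of_isomorphic_dual hG _ hp hq hd0 hpd hqd hE hEB h
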